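/- Let $K$ be an algebraically closed field and let $\mathcal C$ be a $\mathrm{Hom}$-finite $K$-category (every $\mathcal C(X,Y)$ is a finite-dimensional $K$-vector space and composition is $K$-bilinear) which is additive and in which idempotents split. Conventions. A $\mathcal C$-module is a contravariant additive functor from $\mathcal C$ to abelian groups. An ideal of a preadditive category $\mathcal D$ is a subbifunctor of $\mathrm{Hom}_{\mathcal D}$; the product $I_1I_2$ of two ideals consists of the finite sums of composites $X\xrightarrow{h}Y\xrightarrow{g}Z$ with $h\in I_1(X,Y)$, $g\in I_2(Y,Z)$; and $\mathrm{rad}\,\mathcal D(X,Y)$ is the set of $f\colon X\to Y$ such that $1_X-gf$ is invertible for every $g\colon Y\to X$. An ideal $I$ of $\mathcal D$ is called heredity if $I^2=I$, $I\cdot\mathrm{rad}\,\mathcal D\cdot I=0$, and $I(-,X)$ is a finitely generated projective $\mathcal D$-module for every $X\in\mathcal D$. For a full subcategory $\mathcal B\subseteq\mathcal C$ containing the zero objects and closed under finite direct sums, $I_{\mathcal B}$ is the ideal of $\mathcal C$ of all morphisms that factor through an object of $\mathcal B$. Let $\{\mathcal B_i\}_{i\ge 0}$, $\{0\}=\mathcal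 B_0\subseteq\mathcal B_1\subseteq\cdots\subseteq\mathcal C$, $\bigcup_{i\ge 0}\mathcal B_i=\mathcal C$, be an exhaustive filtration of $\mathcal C$ into full subcategories closed under finite direct sums and under direct summands. The category $\mathcal C$ is called quasi-hereditary with respect to $\{\mathcal B_i\}_{i\ge0}$ if, for every $i\ge 1$, $I_{\mathcal B_i}/I_{\mathcal B_{i-1}}$ is a heredity ideal of the quotient category $\mathcal C/I_{\mathcal B_{i-1}}$. Theorem. $\mathcal C$ is quasi-hereditary with respect to $\{\mathcal B_i\}_{i\ge 0}$ if and only if the following two conditions hold. (i) For every $j\ge 1$ and all indecomposable $E,E'\in\mathcal B_j$ such that neither $E$ nor $E'$ is a direct summand of an object of $\mathcal B_{j-1}$, one has $\mathrm{rad}\,\mathcal C(E,E')=I_{\mathcal B_{j-1}}(E,E')$. (ii) For every $X\in\mathcal C$ and every $j\ge 1$ there is an exact sequence of $\mathcal C$-modules $$\mathcal C(-,E_{j-1})\to\mathcal C(-,E_j)\to I_{\mathcal B_j}(-,X)\to 0$$ with $E_j\in\mathcal B_j$ and $E_{j-1}\in\mathcal B_{j-1}$. -/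

import Mathlib

open CategoryTheory CategoryTheory.Limits

universe w v u

noncomputable section

namespace QHCat

/-! ### Ideals of a preadditive category -/

/-- A two-sided ideal of a preadditive category: a subbifunctor of `Hom`. -/
@[ext]
structure CatIdeal (C : Type u) [Category.{v} C] [Preadditive C] where
  /-- the subgroup of `Hom(X, Y)` -/
  mor : ∀ X Y : C, AddSubgroup (X ⟶ Y)
  comp_left : ∀ {X Y Z : C} (h : X ⟶ Y) {f : Y ⟶ Z}, f ∈ mor Y Z → h ≫ f ∈ mor X Z
  comp_right : ∀ {X Y Z : C} {f : X ⟶ Y} (h : Y ⟶ Z), f ∈ mor X Y → f ≫ h ∈ mor X Z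

namespace CatIdeal

variable {C : Type u} [Category.{v} C] [Preadditive C]

/-- The zero ideal. -/
def zero (C : Type u) [Category.{v} C] [Preadditive C] : CatIdeal C where
  mor _ _ := ⊥
  comp_left h f hf := by
    rw [AddSubgroup.mem_bot] at hf ⊢; rw [hf, comp_zero]
  comp_right h hf := by
    rw [AddSubgroup.mem_bot] at hf ⊢; rw [hf, zero_comp]

/-- The product `I J`: finite sums of composites `X ⟶ Y ⟶ Z` with the first map in `I` and the
second map in `J`. (The set of such composites is closed under negation, so the subgroup it
generates is the set of finite sums.) -/
def mul (I J : CatIdeal C) : CatIdeal C where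
  mor X Z := AddSubgroup.closure
    {f | ∃ (Y : C) (h : X ⟶ Y) (g : Y ⟶ Z), h ∈ I.mor X Y ∧ g ∈ J.mor Y Z ∧ h ≫ g = f}
  comp_left {X Y Z} k f hf := by
    induction hf using AddSubgroup.closure_induction with
    | mem f hf =>
      obtain ⟨W, h, g, hh, hg, rfl⟩ := hf
      exact AddSubgroup.subset_closure
        ⟨W, k ≫ h, g, I.comp_left k hh, hg, Category.assoc _ _ _⟩
    | zero => rw [comp_zero]; exact zero_mem _
    | add a b _ _ ha hb => rw [Preadditive.comp_add]; exact add_mem ha hb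
    | neg a _ ha => rw [Preadditive.comp_neg]; exact neg_mem ha
  comp_right {X Y Z} f k hf := by
    induction hf using AddSubgroup.closure_induction with
    | mem f hf =>
      obtain ⟨W, h, g, hh, hg, rfl⟩ := hf
      exact AddSubgroup.subset_closure
        ⟨W, h, g ≫ k, hh, J.comp_right k hg, (Category.assoc _ _ _).symm⟩
    | zero => rw [zero_comp]; exact zero_mem _
    | add a b _ _ ha hb => rw [Preadditive.add_comp]; exact add_mem ha hb
    | neg a _ ha => rw [Preadditive.neg_comp]; exact neg_mem ha

/-- If `1 - f g` is invertible then so is `1 - g f`. -/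
lemma isIso_one_sub_swap {X Y : C} (f : X ⟶ Y) (g : Y ⟶ X)
    (h : IsIso (𝟙 X - f ≫ g)) : IsIso (𝟙 Y - g ≫ f) := by
  obtain ⟨k, hk₁, hk₂⟩ := h
  have e₁ : k - f ≫ g ≫ k = 𝟙 X := by
    simpa [Preadditive.sub_comp, Category.assoc] using hk₁
  have e₂ : k - k ≫ f ≫ g = 𝟙 X := by
    simpa [Preadditive.comp_sub] using hk₂
  have e₁' : f ≫ g ≫ k = k - 𝟙 X := by rw [← e₁]; abel
  have e₂' : k ≫ f ≫ g = k - 𝟙 X := by rw [← e₂]; abel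
  refine ⟨𝟙 Y + g ≫ k ≫ f, ?_, ?_⟩
  · have : g ≫ f ≫ g ≫ k ≫ f = g ≫ (k - 𝟙 X) ≫ f := by
      rw [← e₁']; simp only [Category.assoc]
    simp only [Preadditive.sub_comp, Preadditive.comp_add, Category.id_comp, Category.comp_id,
      Category.assoc, this, Preadditive.comp_sub]
    abel
  · have : g ≫ k ≫ f ≫ g ≫ f = g ≫ (k - 𝟙 X) ≫ f := by
      rw [← e₂']; simp only [Category.assoc]
    simp only [Preadditive.comp_sub, Preadditive.add_comp, Category.id_comp, Category.comp_id,
      Category.assoc, this, Preadditive.sub_comp]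
    abel

/-- The Jacobson radical of a preadditive category: `f : X ⟶ Y` lies in it if and only if
`1 - g ∘ f` is invertible for every `g : Y ⟶ X`. -/
def rad (C : Type u) [Category.{v} C] [Preadditive C] : CatIdeal C where
  mor X Y :=
    { carrier := {f | ∀ g : Y ⟶ X, IsIso (𝟙 X - f ≫ g)}
      zero_mem' := fun g => by
        rw [zero_comp, sub_zero]; infer_instance
      add_mem' := by
        intro a b ha hb g
        have h₁ : IsIso (𝟙 X - a ≫ g) := ha g
        have h₂ : IsIso (𝟙 Y - (g ≫ inv (𝟙 X - a ≫ g)) ≫ b) := by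
          apply isIso_one_sub_swap
          exact hb _
        have h₃ : IsIso (𝟙 X - (inv (𝟙 X - a ≫ g) ≫ b) ≫ g) := by
          apply isIso_one_sub_swap
          simpa only [Category.assoc] using h₂
        have h₄ : 𝟙 X - (a + b) ≫ g
            = (𝟙 X - a ≫ g) ≫ (𝟙 X - (inv (𝟙 X - a ≫ g) ≫ b) ≫ g) := by
          rw [Preadditive.comp_sub, Category.comp_id, Category.assoc, IsIso.hom_inv_id_assoc,
            Preadditive.add_comp]
          abel
        rw [h₄]
        infer_instance
      neg_mem' := by
        intro a ha g
        have := ha (-g)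
        simpa using this }
  comp_left {X Y Z} h f hf g := by
    have h₁ : IsIso (𝟙 Y - (f ≫ g) ≫ h) := by
      simpa only [Category.assoc] using hf (g ≫ h)
    have := isIso_one_sub_swap (f ≫ g) h h₁
    simpa only [Category.assoc] using this
  comp_right {X Y Z} f h hf g := by
    simpa only [Category.assoc] using hf (h ≫ g)

/-! ### The quotient category `C / I` -/

/-- Two parallel morphisms are identified in `C / I` when their difference is in `I`. -/
def rel (I : CatIdeal C) : HomRel C := fun X Y f g => f - g ∈ I.mor X Y

instance (I : CatIdeal C) : Congruence I.rel where
  equivalence :=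
    { refl := fun f => by
        change f - f ∈ _
        rw [sub_self]; exact zero_mem _
      symm := fun {f g} h => by
        change g - f ∈ _
        rw [← neg_sub]; exact neg_mem h
      trans := fun {f g k} h₁ h₂ => by
        change f - k ∈ _
        rw [← sub_add_sub_cancel f g k]; exact add_mem h₁ h₂ }
  comp_left h _ _ hfg := by
    change _ - _ ∈ _
    rw [← Preadditive.comp_sub]; exact I.comp_left h hfg
  comp_right h hfg := by
    change _ - _ ∈ _
    rw [← Preadditive.sub_comp]; exact I.comp_right h hfg

/-- The quotient category `C / I`: the objects of `C`, with morphism groups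
`Hom(X, Y) / I(X, Y)`. -/
abbrev QuotCat (I : CatIdeal C) := CategoryTheory.Quotient I.rel

/-- The projection `C ⥤ C / I`. -/
abbrev proj (I : CatIdeal C) : C ⥤ I.QuotCat := CategoryTheory.Quotient.functor I.rel

lemma rel_add (I : CatIdeal C) ⦃X Y : C⦄ (f₁ f₂ g₁ g₂ : X ⟶ Y) (hf : I.rel f₁ f₂)
    (hg : I.rel g₁ g₂) : I.rel (f₁ + g₁) (f₂ + g₂) := by
  change _ - _ ∈ _
  rw [add_sub_add_comm]; exact add_mem hf hg

instance (I : CatIdeal C) : Preadditive I.QuotCat :=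
  CategoryTheory.Quotient.preadditive I.rel I.rel_add

instance (I : CatIdeal C) : I.proj.Additive :=
  CategoryTheory.Quotient.functor_additive I.rel I.rel_add

/-- The ideal of `C / I` consisting of the residue classes of the morphisms in `J`; for `I ≤ J`
this is the ideal `J / I`. -/
def modulo (J I : CatIdeal C) : CatIdeal I.QuotCat where
  mor X Y := (J.mor X.as Y.as).map (I.proj.mapAddHom (X := X.as) (Y := Y.as))
  comp_left {X Y Z} h f hf := by
    obtain ⟨f, hf, rfl⟩ := hf
    obtain ⟨h, rfl⟩ := I.proj.map_surjective (X := X.as) (Y := Y.as) h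
    exact ⟨h ≫ f, J.comp_left h hf, I.proj.map_comp h f⟩
  comp_right {X Y Z} f h hf := by
    obtain ⟨f, hf, rfl⟩ := hf
    obtain ⟨h, rfl⟩ := I.proj.map_surjective (X := Y.as) (Y := Z.as) h
    exact ⟨f ≫ h, J.comp_right h hf, I.proj.map_comp f h⟩

end CatIdeal

/-! ### Modules over a preadditive category -/

/-- `Mod(C)`: contravariant additive functors from `C` to abelian groups. -/
abbrev Mod (C : Type u) [Category.{v} C] [Preadditive C] :=
  Cᵒᵖ ⥤+ AddCommGrpCat.{v}

section Modules

variable {C : Type u} [Category.{v} C] [Preadditive C]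

/-- The representable module `C(-, E)`. -/
def representable (E : C) : Mod C := AdditiveFunctor.of (preadditiveYoneda.obj E)

/-- The component at `Y` of a morphism of modules, as a homomorphism of groups. -/
def component {M N : Mod C} (a : M ⟶ N) (Y : C) :
    M.obj.obj (Opposite.op Y) →+ N.obj.obj (Opposite.op Y) :=
  (a.hom.app (Opposite.op Y)).hom

/-- The subfunctor `I(-, X)` of `C(-, X)` given by an ideal `I`. -/
def CatIdeal.subfunctor (I : CatIdeal C) (X : C) : Cᵒᵖ ⥤ AddCommGrpCat.{v} where
  obj Y := AddCommGrpCat.of (I.mor Y.unop X)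
  map h := AddCommGrpCat.ofHom
    { toFun := fun f => ⟨h.unop ≫ f.1, I.comp_left h.unop f.2⟩
      map_zero' := Subtype.ext comp_zero
      map_add' := fun _ _ => Subtype.ext (Preadditive.comp_add _ _ _ _ _ _) }
  map_id Y := AddCommGrpCat.ext fun f : I.mor Y.unop X => Subtype.ext (Category.id_comp f.1)
  map_comp {Y _ _} g h := AddCommGrpCat.ext fun f : I.mor Y.unop X =>
    Subtype.ext (Category.assoc h.unop g.unop f.1)

instance (I : CatIdeal C) (X : C) : (I.subfunctor X).Additive where
  map_add {Y _ g h} := AddCommGrpCat.ext fun f : I.mor Y.unop X =>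
    Subtype.ext (Preadditive.add_comp _ _ _ g.unop h.unop f.1)

/-- The module `I(-, X)`. -/
def CatIdeal.submodule (I : CatIdeal C) (X : C) : Mod C :=
  AdditiveFunctor.of (I.subfunctor X)

/-- `M` is finitely generated: there is an epimorphism `C(-, E₁) ⊕ ⋯ ⊕ C(-, Eₙ) ⟶ M`, that is,
there are finitely many morphisms `p i : C(-, E i) ⟶ M` such that every element of `M(Y)` is of
the form `∑ i, p i (g i)` with `g i : Y ⟶ E i`. -/
def IsFinGen (M : Mod C) : Prop :=
  ∃ (n : ℕ) (E : Fin n → C) (p : ∀ i, representable (E i) ⟶ M),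
    ∀ (Y : C) (m : M.obj.obj (Opposite.op Y)),
      ∃ g : ∀ i, (representable (E i)).obj.obj (Opposite.op Y), m = ∑ i, component (p i) Y (g i)

/-- The sequence of modules `L ⟶ M ⟶ N ⟶ 0` is exact (exactness in `Mod(C)` is objectwise). -/
def IsRightExact {L M N : Mod C} (a : L ⟶ M) (p : M ⟶ N) : Prop :=
  ∀ Y : C, Function.Exact (component a Y) (component p Y) ∧
    Function.Surjective (component p Y)

/-! ### Heredity ideals -/

/-- An ideal `I` is heredity if `I² = I`, `I · rad · I = 0`, and each `I(-, X)` is a finitely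
generated projective module. -/
structure CatIdeal.IsHeredity (I : CatIdeal C) : Prop where
  idem : I.mul I = I
  mul_rad_mul : (I.mul (CatIdeal.rad C)).mul I = CatIdeal.zero C
  finGen : ∀ X : C, IsFinGen (I.submodule X)
  projective : ∀ X : C, Projective (I.submodule X)

end Modules

/-! ### Filtrations into subcategories -/

section Filtrations

variable {C : Type u} [Category.{v} C] [Preadditive C] [HasZeroObject C]
  [HasBinaryBiproducts C]

/-- A full subcategory (given by its objects) containing the zero objects and closed under
finite direct sums. -/
structure IsAdditiveSubcategory (B : ObjectProperty C) : Prop where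
  of_isZero : ∀ X, IsZero X → B X
  biprod : ∀ X Y, B X → B Y → B (X ⊞ Y)

/-- The ideal `I_B` of the morphisms which factor through some object of `B`. -/
def factorIdeal (B : ObjectProperty C) (hB : IsAdditiveSubcategory B) : CatIdeal C where
  mor X Y :=
    { carrier := {f | ∃ (E : C) (a : X ⟶ E) (b : E ⟶ Y), B E ∧ a ≫ b = f}
      zero_mem' := by
        obtain ⟨Z, hZ⟩ := HasZeroObject.zero (C := C)
        exact ⟨Z, 0, 0, hB.of_isZero Z hZ, zero_comp⟩
      add_mem' := by
        rintro _ _ ⟨E, a, b, hE, rfl⟩ ⟨E', a', b', hE', rfl⟩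
        exact ⟨E ⊞ E', biprod.lift a a', biprod.desc b b', hB.biprod _ _ hE hE',
          biprod.lift_desc⟩
      neg_mem' := by
        rintro _ ⟨E, a, b, hE, rfl⟩
        exact ⟨E, -a, b, hE, Preadditive.neg_comp _ _⟩ }
  comp_left h f hf := by
    obtain ⟨E, a, b, hE, rfl⟩ := hf
    exact ⟨E, h ≫ a, b, hE, Category.assoc _ _ _⟩
  comp_right h hf := by
    obtain ⟨E, a, b, hE, rfl⟩ := hf
    exact ⟨E, a, b ≫ h, hE, (Category.assoc _ _ _).symm⟩

/-- `E` is a direct summand of `F`. -/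
def IsSummand (E F : C) : Prop := ∃ Z : C, Nonempty (F ≅ E ⊞ Z)

/-- `B` is closed under direct summands. -/
def IsClosedUnderSummands (B : ObjectProperty C) : Prop :=
  ∀ E F : C, IsSummand E F → B F → B E

variable (C) in
/-- An exhaustive filtration `{0} = B₀ ⊆ B₁ ⊆ ⋯ ⊆ C`, `⋃ Bᵢ = C`, into full additive
subcategories. -/
structure ExhaustiveFiltration where
  /-- the `i`-th subcategory -/
  sub : ℕ → ObjectProperty C
  additive : ∀ i, IsAdditiveSubcategory (sub i)
  zero : ∀ X, sub 0 X ↔ IsZero X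
  mono : Monotone sub
  exhaustive : ∀ X, ∃ i, sub i X

/-- The ideal `I_{Bᵢ}`. -/
def ExhaustiveFiltration.ideal (B : ExhaustiveFiltration C) (i : ℕ) : CatIdeal C :=
  factorIdeal (B.sub i) (B.additive i)

/-- `C` is quasi-hereditary with respect to `{Bᵢ}`: for `i ≥ 1` the ideal `I_{Bᵢ} / I_{Bᵢ₋₁}` of
the category `C / I_{Bᵢ₋₁}` is heredity. -/
def IsQuasiHereditary (B : ExhaustiveFiltration C) : Prop :=
  ∀ i : ℕ, 1 ≤ i → ((B.ideal i).modulo (B.ideal (i - 1))).IsHeredity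

end Filtrations

end QHCat

end

/-! Write $I_j$ for $I_{\mathcal B_j}$. Idempotence of $I_j/I_{j-1}$ is automatic, since a morphism
through $E\in\mathcal B_j$ is a composite of two morphisms of $I_j$. The other heredity axioms
separate: $I\cdot\mathrm{rad}\cdot I=0$ corresponds to (i), and finitely generated projectivity to
(ii).

For (i), $I\cdot\mathrm{rad}\cdot I=0$ amounts to the vanishing of the radical of $\mathcal
C/I_{j-1}$ between objects of $\mathcal B_j$. By Krull–Schmidt it suffices to test this on
indecomposables, whose endomorphism rings are local (`ideal_le_rad`, `rad_le_ideal_of_isHeredity`,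
`mem_ideal_of_proj_mem_rad`).

For (ii), the Yoneda lemma turns the sequence into morphisms $k\colon E_{j-1}\to E_j$ and $p\colon
E_j\to X$ with two lifting properties. Modulo $I_{j-1}$ the relations disappear, so
$(I_j/I_{j-1})(-,X)$ is represented by $E_j$ (`finGen_projective_of_hasPresentation`). Conversely, a
finitely generated projective $(I_j/I_{j-1})(-,X)$ is cut out by an idempotent of
$\mathrm{End}(E)/I_{j-1}(E,E)$ for some $E\in\mathcal B_j$. It lifts to the finite-dimensional
algebra $\mathrm{End}(E)$ and splits there, which gives a representing object
(`exists_representing`). Induction on $j$ then glues this layer to the presentations at $j-1$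
(`hasPresentation_succ`). -/

namespace QHCat

/-! ### Idempotents in finite-dimensional algebras -/

/-- Every element of a finite-dimensional algebra has a power which is associated with an
idempotent. -/
lemma exists_idempotent_of_pow (K : Type*) {R : Type*} [Field K] [Ring R] [Algebra K R]
    [FiniteDimensional K R] (a : R) :
    ∃ (n : ℕ) (f b : R), f * f = f ∧ a ^ (n + 1) * f = a ^ (n + 1) ∧ f = a ^ (n + 1) * b ∧
      f = b * a ^ (n + 1) := by
  -- The descending chain of ideals $(a^n)$ stabilises in the commutative Artinian ring $K[a]$.
  obtain ⟨n, y, hc, hy⟩ : ∃ (n : ℕ) (y : R), Commute a y ∧ a ^ n = a ^ (n + 1) * y := by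
    let S := Algebra.adjoin K {a}
    have : IsMulCommutative S := Algebra.isMulCommutative_adjoin K (by rintro x rfl y rfl; rfl)
    let _ : CommRing S := inferInstance
    have : IsArtinianRing S := IsArtinianRing.of_finite K S
    obtain ⟨n, y, hy⟩ := IsArtinian.exists_pow_succ_smul_dvd
      (⟨a, Algebra.self_mem_adjoin_singleton K a⟩ : S) (1 : S)
    refine ⟨n, y, ?_, ?_⟩
    · exact congrArg Subtype.val (mul_comm (⟨a, Algebra.self_mem_adjoin_singleton K a⟩ : S) y)
    · have := congrArg Subtype.val hy
      simpa using this.symm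
  have key : ∀ k : ℕ, a ^ n = a ^ (n + k) * y ^ k := by
    intro k
    induction k with
    | zero => simp
    | succ k ih =>
      calc a ^ n = a ^ k * a ^ n * y ^ k := by rw [← pow_add, add_comm k n]; exact ih
        _ = a ^ k * (a ^ (n + 1) * y) * y ^ k := by rw [← hy]
        _ = _ := by rw [← mul_assoc, ← pow_add, mul_assoc, ← pow_succ']; congr 2; omega
  have hcy : Commute (a ^ (n + 1)) (y ^ (n + 1)) := hc.pow_pow _ _
  have h1 : a ^ (n + 1) * (a ^ (n + 1) * y ^ (n + 1)) = a ^ (n + 1) := by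
    conv_rhs => rw [pow_succ', key (n + 1)]
    rw [← mul_assoc, ← mul_assoc, ← pow_add, ← pow_succ']; congr 2; omega
  refine ⟨n, a ^ (n + 1) * y ^ (n + 1), y ^ (n + 1), ?_, h1, rfl, hcy⟩
  calc _ = y ^ (n + 1) * (a ^ (n + 1) * (a ^ (n + 1) * y ^ (n + 1))) := by
        rw [hcy.eq]; simp only [mul_assoc]
    _ = _ := by rw [h1, hcy.eq]

/-- Idempotents lift along surjections of finite-dimensional algebras. -/
lemma exists_idempotent_lift (K : Type*) {R S : Type*} [Field K] [Ring R] [Algebra K R]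
    [FiniteDimensional K R] [Ring S] (φ : R →+* S) (a : R) (ha : φ a * φ a = φ a) :
    ∃ f : R, f * f = f ∧ φ f = φ a := by
  obtain ⟨n, f, b, hf, h1, h2, -⟩ := exists_idempotent_of_pow K a
  have hn : φ (a ^ (n + 1)) = φ a := by
    rw [map_pow]
    exact IsIdempotentElem.pow_succ_eq n ha
  refine ⟨f, hf, ?_⟩
  have e1 : φ a * φ f = φ a := by simpa [hn] using congrArg φ h1
  have e2 : φ f = φ a * φ b := by rw [← hn, ← map_mul, ← h2]
  calc φ f = φ a * φ a * φ b := by rw [ha, e2]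
    _ = φ a := by rw [mul_assoc, ← e2, e1]

/-- In a finite-dimensional algebra with only trivial idempotents, every element is a unit or
nilpotent. -/
lemma isUnit_or_isNilpotent (K : Type*) {R : Type*} [Field K] [Ring R] [Algebra K R]
    [FiniteDimensional K R] (h : ∀ f : R, f * f = f → f = 0 ∨ f = 1) (a : R) :
    IsUnit a ∨ IsNilpotent a := by
  obtain ⟨n, f, b, hf, h1, h2, h3⟩ := exists_idempotent_of_pow K a
  rcases h f hf with rfl | rfl
  · exact Or.inr ⟨n + 1, by rw [← h1, mul_zero]⟩
  · left
    have : IsUnit (a ^ (n + 1)) := ⟨⟨_, b, h2.symm, h3.symm⟩, rfl⟩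
    exact (isUnit_pow_iff (Nat.succ_ne_zero n)).1 this

/-! ### Decompositions of objects -/

section Additive

variable {C : Type u} [Category.{v} C] [Preadditive C] [HasBinaryBiproducts C]

/-- Complementary idempotents which split give a direct sum decomposition. -/
noncomputable def isoBiprodOfSplit {X Y Z : C} (i : Y ⟶ X) (e : X ⟶ Y) (i' : Z ⟶ X) (e' : X ⟶ Z)
    (h : i ≫ e = 𝟙 Y) (h' : i' ≫ e' = 𝟙 Z) (ht : e ≫ i + e' ≫ i' = 𝟙 X) : X ≅ Y ⊞ Z :=
  -- Orthogonality is a consequence: precomposing `ht` with `i` gives `i ≫ e' ≫ i' = 0`, and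
  -- composing with `e'` removes `i'`.
  have h₁ : i ≫ e' = 0 := by
    have e1 : i + i ≫ e' ≫ i' = i := by
      have := i ≫= ht
      rwa [Preadditive.comp_add, reassoc_of% h, Category.comp_id] at this
    have e2 : i ≫ e' ≫ i' = 0 := by simpa using e1
    have := e2 =≫ e'
    simpa [h'] using this
  have h₂ : i' ≫ e = 0 := by
    have e1 : i' ≫ e ≫ i + i' = i' := by
      have := i' ≫= ht
      rwa [Preadditive.comp_add, reassoc_of% h', Category.comp_id] at this
    have e2 : i' ≫ e ≫ i = 0 := by simpa using e1
    have := e2 =≫ e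
    simpa [h] using this
  { hom := biprod.lift e e'
    inv := biprod.desc i i'
    hom_inv_id := by rw [biprod.lift_desc, ht]
    inv_hom_id := by ext <;> simp [h, h', h₁, h₂] }

lemma isSummand_of_retract [IsIdempotentComplete C] {X Y : C} (i : Y ⟶ X) (e : X ⟶ Y)
    (h : i ≫ e = 𝟙 Y) : IsSummand Y X := by
  obtain ⟨Z, i', e', h1, h2⟩ := IsIdempotentComplete.idempotents_split X (𝟙 X - e ≫ i)
    (Idempotents.idem_of_id_sub_idem _ (by rw [Category.assoc, reassoc_of% h]))
  exact ⟨Z, ⟨isoBiprodOfSplit i e i' e' h h1 (by rw [h2]; abel)⟩⟩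

lemma idempotent_eq_zero_or_one [IsIdempotentComplete C] {X : C} (hX : Indecomposable X)
    (p : X ⟶ X) (hp : p ≫ p = p) : p = 0 ∨ p = 𝟙 X := by
  obtain ⟨Y, i, e, h1, h2⟩ := IsIdempotentComplete.idempotents_split X p hp
  obtain ⟨Z, i', e', h1', h2'⟩ := IsIdempotentComplete.idempotents_split X (𝟙 X - p)
    (Idempotents.idem_of_id_sub_idem _ hp)
  rcases hX.2 Y Z (isoBiprodOfSplit i e i' e' h1 h1' (by rw [h2, h2']; abel)) with hz | hz
  · left
    rw [← h2, hz.eq_of_tgt e 0, zero_comp]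
  · right
    rw [hz.eq_of_tgt e' 0, zero_comp] at h2'
    exact (sub_eq_zero.1 h2'.symm).symm

variable (K : Type w) [Field K] [Linear K C] (homFinite : ∀ X Y : C, FiniteDimensional K (X ⟶ Y))
include homFinite

/-- In the endomorphism ring of an indecomposable object, the non-invertible elements are
nilpotent; in particular the ring is local. -/
lemma isIso_of_not_isIso_one_sub [IsIdempotentComplete C] {X : C} (hX : Indecomposable X)
    (f : X ⟶ X) (hf : ¬ IsIso (𝟙 X - f)) : IsIso f := by
  have : FiniteDimensional K (End X) := homFinite X X
  rcases isUnit_or_isNilpotent K (R := End X)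
    (fun p hp => idempotent_eq_zero_or_one hX p hp) (End.of f) with h | h
  · exact (isUnit_iff_isIso f).1 h
  · exact absurd ((isUnit_iff_isIso _).1 h.isUnit_one_sub) hf

/-- Krull–Schmidt, as an induction principle. -/
lemma induction_on_indecomposables [HasZeroObject C] (P : C → Prop)
    (zero : ∀ X, IsZero X → P X) (indec : ∀ X, Indecomposable X → P X)
    (sum : ∀ X Y Z, (X ≅ Y ⊞ Z) → P Y → P Z → P X) (X : C) : P X := by
  have pos : ∀ X : C, ¬ IsZero X → 0 < Module.finrank K (X ⟶ X) := by
    intro X hX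
    have := homFinite X X
    have : Nontrivial (X ⟶ X) := ⟨𝟙 X, 0, fun h => hX ((IsZero.iff_id_eq_zero X).2 h)⟩
    exact Module.finrank_pos
  have add : ∀ X Y Z : C, (X ≅ Y ⊞ Z) →
      Module.finrank K (Y ⟶ Y) + Module.finrank K (Z ⟶ Z) ≤ Module.finrank K (X ⟶ X) := by
    intro X Y Z φ
    have := homFinite X X
    have := homFinite Y Y
    have := homFinite Z Z
    rw [← Module.finrank_prod]
    let L : ((Y ⟶ Y) × (Z ⟶ Z)) →ₗ[K] (X ⟶ X) :=
      { toFun := fun a => φ.hom ≫ biprod.map a.1 a.2 ≫ φ.inv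
        map_add' := fun a b => by
          have : biprod.map (a + b).1 (a + b).2 = biprod.map a.1 a.2 + biprod.map b.1 b.2 := by
            ext <;> simp
          rw [this]; simp
        map_smul' := fun c a => by
          have : biprod.map (c • a).1 (c • a).2 = c • biprod.map a.1 a.2 := by
            ext <;> simp
          rw [this]; simp }
    refine LinearMap.finrank_le_finrank_of_injective (f := L) ?_
    intro a b hab
    have hab' : biprod.map a.1 a.2 = biprod.map b.1 b.2 := by
      have h : φ.hom ≫ biprod.map a.1 a.2 ≫ φ.inv = φ.hom ≫ biprod.map b.1 b.2 ≫ φ.inv := hab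
      simpa using h
    refine Prod.ext ?_ ?_
    · simpa using biprod.inl ≫= hab' =≫ biprod.fst
    · simpa using biprod.inr ≫= hab' =≫ biprod.snd
  -- Block-diagonal endomorphisms embed in $\mathrm{End}(X)$, so each of two nonzero summands has a
  -- strictly smaller endomorphism algebra.
  induction hn : Module.finrank K (X ⟶ X) using Nat.strong_induction_on generalizing X with
  | _ n ih =>
    by_cases h0 : IsZero X
    · exact zero X h0
    by_cases h1 : Indecomposable X
    · exact indec X h1
    obtain ⟨Y, Z, φ, hY, hZ⟩ : ∃ (Y Z : C) (_ : X ≅ Y ⊞ Z), ¬ IsZero Y ∧ ¬ IsZero Z := by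
      by_contra hcon
      refine h1 ⟨h0, fun Y Z φ => ?_⟩
      by_contra hYZ
      rw [not_or] at hYZ
      exact hcon ⟨Y, Z, φ, hYZ⟩
    have := add X Y Z φ
    have := pos Y hY
    have := pos Z hZ
    exact sum X Y Z φ (ih _ (by omega) Y rfl) (ih _ (by omega) Z rfl)

end Additive

end QHCat

noncomputable section

namespace QHCat

open Opposite

/-! ### Modules -/

section Modules

variable {C : Type u} [Category.{v} C] [Preadditive C]

lemma component_naturality {M N : Mod C} (a : M ⟶ N) {Y Z : C} (h : Y ⟶ Z)
    (x : M.obj.obj (op Z)) :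
    component a Y ((M.obj.map h.op).hom x) = (N.obj.map h.op).hom (component a Z x) := by
  have := congrArg (fun φ => AddCommGrpCat.Hom.hom φ x) (a.hom.naturality h.op)
  exact this

lemma mod_hom_ext {M N : Mod C} {a b : M ⟶ N}
    (h : ∀ (Y : C) (x : M.obj.obj (op Y)), component a Y x = component b Y x) : a = b := by
  apply ObjectProperty.hom_ext
  ext Y x
  exact h Y.unop x

/-- Construct a morphism of modules from its components. -/
def modHomMk {M N : Mod C} (f : ∀ Y : C, M.obj.obj (op Y) →+ N.obj.obj (op Y))
    (hf : ∀ {Y Z : C} (h : Y ⟶ Z) (x : M.obj.obj (op Z)),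
      f Y ((M.obj.map h.op).hom x) = (N.obj.map h.op).hom (f Z x)) : M ⟶ N :=
  ObjectProperty.homMk
    { app := fun Y => AddCommGrpCat.ofHom (f Y.unop)
      naturality := fun Y Z h => by
        ext x
        exact hf h.unop x }

/-- The Yoneda correspondence for a module `M`. -/
def ofElement {M : Mod C} {E : C} (m : M.obj.obj (op E)) : representable E ⟶ M :=
  modHomMk
    (fun Y =>
      { toFun := fun g : Y ⟶ E => (M.obj.map g.op).hom m
        map_zero' := 
          congrArg (fun φ => AddCommGrpCat.Hom.hom φ m)
            (show M.obj.map (0 : Y ⟶ E).op = 0 by rw [op_zero, Functor.map_zero])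
        map_add' := fun g h : Y ⟶ E =>
          congrArg (fun φ => AddCommGrpCat.Hom.hom φ m)
            (show M.obj.map (g + h).op = M.obj.map g.op + M.obj.map h.op by
              rw [op_add, Functor.map_add]) })
    (fun {Y Z} h (x : Z ⟶ E) => by
      change (M.obj.map (h ≫ x).op).hom m = (M.obj.map h.op).hom ((M.obj.map x.op).hom m)
      rw [op_comp, Functor.map_comp]; rfl)

lemma component_eq_map {M : Mod C} {E : C} (a : representable E ⟶ M) {Y : C} (g : Y ⟶ E) :
    component a Y g = (M.obj.map g.op).hom (component a E (𝟙 E)) := by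
  have := component_naturality a g (𝟙 E)
  rw [← this]
  congr 1
  exact (Category.comp_id g).symm

lemma component_representable {E E' : C} (a : representable E ⟶ representable E') {Y : C}
    (g : Y ⟶ E) : component a Y g = (g ≫ (show E ⟶ E' from component a E (𝟙 E)) : Y ⟶ E') :=
  component_eq_map a g

/-- The morphism `C(-, E) ⟶ I(-, X)` given by an element of `I(E, X)`. -/
def CatIdeal.ofMem (I : CatIdeal C) {E X : C} (p : E ⟶ X) (hp : p ∈ I.mor E X) :
    representable E ⟶ I.submodule X :=
  ofElement (M := I.submodule X) (⟨p, hp⟩ : I.mor E X)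

/-- The element of `I(E, X)` corresponding to a morphism `C(-, E) ⟶ I(-, X)`. -/
def CatIdeal.element (I : CatIdeal C) {E X : C} (a : representable E ⟶ I.submodule X) :
    I.mor E X := component a E (𝟙 E)

lemma CatIdeal.component_eq (I : CatIdeal C) {E X : C} (a : representable E ⟶ I.submodule X)
    {Y : C} (g : Y ⟶ E) :
    component a Y g = (⟨g ≫ (I.element a).1, I.comp_left g (I.element a).2⟩ : I.mor Y X) :=
  component_eq_map a g

lemma mod_epi_of_surjective {M N : Mod C} (a : M ⟶ N)
    (h : ∀ Y, Function.Surjective (component a Y)) : Epi a where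
  left_cancellation b c hbc := by
    apply mod_hom_ext
    intro Y x
    obtain ⟨x, rfl⟩ := h Y x
    exact congrArg (fun φ => component φ Y x) hbc

/-- The functor underlying the cokernel of a morphism of modules. -/
def cokernelFunctor {M N : Mod C} (a : M ⟶ N) : Cᵒᵖ ⥤ AddCommGrpCat.{v} where
  obj Y := AddCommGrpCat.of (N.obj.obj Y ⧸ (component a Y.unop).range)
  map {Y Z} h := AddCommGrpCat.ofHom
    (QuotientAddGroup.map _ _ (N.obj.map h).hom (by
      rintro _ ⟨x, rfl⟩
      exact ⟨(M.obj.map h).hom x, component_naturality a h.unop x⟩))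
  map_id Y := by
    apply AddCommGrpCat.hom_ext
    apply QuotientAddGroup.addMonoidHom_ext
    ext x
    simp
  map_comp {X Y Z} g h := by
    apply AddCommGrpCat.hom_ext
    apply QuotientAddGroup.addMonoidHom_ext
    ext x
    simp

instance {M N : Mod C} (a : M ⟶ N) : (cokernelFunctor a).Additive where
  map_add {X Y g h} := by
    apply AddCommGrpCat.hom_ext
    apply QuotientAddGroup.addMonoidHom_ext
    ext x
    change QuotientAddGroup.mk ((N.obj.map (g + h)).hom x) = _
    rw [Functor.map_add]
    rfl

/-- The projection to the cokernel and the zero map agree after `a`, hence are equal, so the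
objectwise cokernel vanishes. -/
lemma surjective_of_mod_epi {M N : Mod C} (a : M ⟶ N) [Epi a] (Y : C) :
    Function.Surjective (component a Y) := by
  let Q : Mod C := AdditiveFunctor.of (cokernelFunctor a)
  let π : N ⟶ Q := modHomMk (fun Y => QuotientAddGroup.mk' (component a Y).range)
    (fun _ _ => rfl)
  let z : N ⟶ Q := modHomMk (fun Y => 0) (fun h x => (map_zero _).symm)
  have h : π = z := by
    rw [← cancel_epi a]
    apply mod_hom_ext
    intro Y x
    exact (QuotientAddGroup.eq_zero_iff _).2 ⟨x, rfl⟩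
  intro y
  have := congrArg (fun φ => component φ Y y) h
  exact (QuotientAddGroup.eq_zero_iff _).1 this

instance representable_projective (E : C) : Projective (representable E) where
  factors {M N} f e _ := by
    obtain ⟨m, hm⟩ := surjective_of_mod_epi e E (component f E (𝟙 E))
    refine ⟨ofElement m, ?_⟩
    apply mod_hom_ext
    intro Y g
    have h₁ : component e Y ((M.obj.map (show Y ⟶ E from g).op).hom m) =
        (N.obj.map (show Y ⟶ E from g).op).hom (component f E (𝟙 E)) := by
      rw [component_naturality, hm]
    exact h₁.trans (component_eq_map f g).symm

/-- A morphism of modules which is objectwise bijective is an isomorphism. -/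
def modIsoOfBijective {M N : Mod C} (a : M ⟶ N)
    (h : ∀ Y, Function.Bijective (component a Y)) : M ≅ N where
  hom := a
  inv := modHomMk (fun Y => (AddEquiv.ofBijective (component a Y) (h Y)).symm.toAddMonoidHom)
    (fun {Y Z} g x => by
      apply (h Y).1
      obtain ⟨x, rfl⟩ := (h Z).2 x
      rw [← component_naturality]
      change component a Y ((AddEquiv.ofBijective (component a Y) (h Y)).symm
        (AddEquiv.ofBijective (component a Y) (h Y) _)) = component a Y ((M.obj.map g.op).hom
          ((AddEquiv.ofBijective (component a Z) (h Z)).symm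
            (AddEquiv.ofBijective (component a Z) (h Z) x)))
      rw [AddEquiv.symm_apply_apply, AddEquiv.symm_apply_apply])
  hom_inv_id := mod_hom_ext fun Y x =>
    (AddEquiv.ofBijective (component a Y) (h Y)).symm_apply_apply x
  inv_hom_id := mod_hom_ext fun Y x =>
    (AddEquiv.ofBijective (component a Y) (h Y)).apply_symm_apply x

/-- Composition with `p` is an isomorphism from a representable module, which is projective by
Yoneda. -/
lemma CatIdeal.projective_of_unique_lift (I : CatIdeal C) {E X : C} (p : E ⟶ X)
    (hp : p ∈ I.mor E X) (surj : ∀ {Y : C} (f : Y ⟶ X), f ∈ I.mor Y X → ∃ g : Y ⟶ E, g ≫ p = f)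
    (inj : ∀ {Y : C} (g : Y ⟶ E), g ≫ p = 0 → g = 0) : Projective (I.submodule X) := by
  refine Projective.of_iso (modIsoOfBijective (I.ofMem p hp) fun Y => ⟨?_, ?_⟩)
    (representable_projective E)
  · rw [injective_iff_map_eq_zero]
    intro g hg
    exact inj g (congrArg Subtype.val (show (⟨(show Y ⟶ E from g) ≫ p, _⟩ : I.mor Y X) = 0 from hg))
  · intro f
    obtain ⟨g, hg⟩ := surj (show I.mor Y X from f).1 (show I.mor Y X from f).2
    exact ⟨g, Subtype.ext hg⟩

/-- If `I(-, X)` is projective and generated by `p : E ⟶ X`, then `p` is a split cover: there is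
an idempotent `e` of `E` such that `p` restricts to an isomorphism `e C(-, E) ≅ I(-, X)`. -/
lemma CatIdeal.exists_idempotent_of_projective (I : CatIdeal C) {E X : C}
    [Projective (I.submodule X)] (p : E ⟶ X)
    (hp : p ∈ I.mor E X) (surj : ∀ {Y : C} (f : Y ⟶ X), f ∈ I.mor Y X → ∃ g : Y ⟶ E, g ≫ p = f) :
    ∃ e : E ⟶ E, e ≫ e = e ∧ e ≫ p = p ∧ ∀ {Y : C} (g : Y ⟶ E), g ≫ p = 0 → g ≫ e = 0 := by
  have : Epi (I.ofMem p hp) := mod_epi_of_surjective _ fun Y f => by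
    obtain ⟨g, hg⟩ := surj (show I.mor Y X from f).1 (show I.mor Y X from f).2
    exact ⟨g, Subtype.ext hg⟩
  obtain ⟨s, hs⟩ := Projective.factors (𝟙 (I.submodule X)) (I.ofMem p hp)
  -- By Yoneda, the cover followed by its section `s` is composition with a single endomorphism of
  -- `E`.
  let e : E ⟶ E := component (I.ofMem p hp ≫ s) E (𝟙 E)
  have he : ∀ {Y : C} (g : Y ⟶ E), component s Y (component (I.ofMem p hp) Y g) = g ≫ e :=
    fun g => component_representable (I.ofMem p hp ≫ s) g
  have hep : e ≫ p = p := by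
    have h : component (s ≫ I.ofMem p hp) E (component (I.ofMem p hp) E (𝟙 E)) =
        component (I.ofMem p hp) E (𝟙 E) := by rw [hs]; rfl
    have h' : component (I.ofMem p hp) E e = component (I.ofMem p hp) E (𝟙 E) := h
    have h'' : e ≫ p = 𝟙 E ≫ p := congrArg Subtype.val
      (show (⟨e ≫ p, _⟩ : I.mor E X) = ⟨𝟙 E ≫ p, I.comp_left _ hp⟩ from h')
    simpa using h''
  have hk : ∀ {Y : C} (g : Y ⟶ E), g ≫ p = 0 → g ≫ e = 0 := by
    intro Y g hg
    rw [← he g]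
    have : component (I.ofMem p hp) Y g = 0 := Subtype.ext hg
    rw [this]
    exact map_zero _
  refine ⟨e, ?_, hep, hk⟩
  -- Since `e ≫ p = p`, the morphism `e - 𝟙 E` is killed by `p`, hence also by `e`.
  have := hk (e - 𝟙 E) (by rw [Preadditive.sub_comp, hep, Category.id_comp, sub_self])
  rw [Preadditive.sub_comp, Category.id_comp] at this
  exact sub_eq_zero.1 this

lemma CatIdeal.isFinGen_of_lift (I : CatIdeal C) {E X : C} (p : E ⟶ X)
    (hp : p ∈ I.mor E X) (surj : ∀ {Y : C} (f : Y ⟶ X), f ∈ I.mor Y X → ∃ g : Y ⟶ E, g ≫ p = f) :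
    IsFinGen (I.submodule X) := by
  refine ⟨1, fun _ => E, fun _ => I.ofMem p hp, fun Y f => ?_⟩
  obtain ⟨g, hg⟩ := surj (show I.mor Y X from f).1 (show I.mor Y X from f).2
  refine ⟨fun _ => g, ?_⟩
  rw [Fin.sum_univ_one]
  exact Subtype.ext hg.symm

lemma CatIdeal.exists_generators (I : CatIdeal C) {X : C} (h : IsFinGen (I.submodule X)) :
    ∃ (n : ℕ) (E : Fin n → C) (p : ∀ i, E i ⟶ X), (∀ i, p i ∈ I.mor (E i) X) ∧
      ∀ {Y : C} (f : Y ⟶ X), f ∈ I.mor Y X → ∃ g : ∀ i, Y ⟶ E i, f = ∑ i, g i ≫ p i := by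
  obtain ⟨n, E, p, h⟩ := h
  refine ⟨n, E, fun i => (I.element (p i)).1, fun i => (I.element (p i)).2, fun {Y} f hf => ?_⟩
  obtain ⟨g, hg⟩ := h Y (⟨f, hf⟩ : I.mor Y X)
  refine ⟨g, ?_⟩
  have h' : (⟨f, hf⟩ : I.mor Y X) = ∑ i, (⟨g i ≫ (I.element (p i)).1,
      I.comp_left (g i) (I.element (p i)).2⟩ : I.mor Y X) := by
    refine hg.trans ?_
    exact Finset.sum_congr rfl fun i _ => I.component_eq (p i) (g i)
  have := congrArg (I.mor Y X).subtype h'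
  rw [map_sum] at this
  exact this

lemma CatIdeal.exists_isRightExact_iff (I : CatIdeal C) (E₀ E₁ X : C) :
    (∃ (a : representable E₀ ⟶ representable E₁) (p : representable E₁ ⟶ I.submodule X),
      IsRightExact a p) ↔
    ∃ (k : E₀ ⟶ E₁) (p : E₁ ⟶ X), p ∈ I.mor E₁ X ∧ k ≫ p = 0 ∧
      (∀ {Y : C} (f : Y ⟶ X), f ∈ I.mor Y X → ∃ g : Y ⟶ E₁, g ≫ p = f) ∧
      (∀ {Y : C} (g : Y ⟶ E₁), g ≫ p = 0 → ∃ t : Y ⟶ E₀, t ≫ k = g) := by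
  constructor
  · rintro ⟨a, p, h⟩
    have ha : ∀ {Y : C} (t : Y ⟶ E₀), component a Y t =
        (t ≫ (show E₀ ⟶ E₁ from component a E₀ (𝟙 E₀)) : Y ⟶ E₁) :=
      fun t => component_representable a t
    refine ⟨component a E₀ (𝟙 E₀), (I.element p).1, (I.element p).2, ?_, ?_, ?_⟩
    · have := ((h E₀).1 (component a E₀ (𝟙 E₀))).2 ⟨_, rfl⟩
      exact congrArg Subtype.val ((I.component_eq p _).symm.trans this)
    · intro Y f hf
      obtain ⟨g, hg⟩ := (h Y).2 (⟨f, hf⟩ : I.mor Y X)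
      exact ⟨g, congrArg Subtype.val ((I.component_eq p g).symm.trans hg)⟩
    · intro Y g hg
      obtain ⟨t, ht⟩ := ((h Y).1 g).1 ((I.component_eq p g).trans (Subtype.ext hg))
      exact ⟨t, (ha t).symm.trans ht⟩
  · rintro ⟨k, p, hp, hk, h1, h2⟩
    refine ⟨ofElement (M := representable E₁) k, I.ofMem p hp, fun Y => ⟨fun g => ⟨?_, ?_⟩, ?_⟩⟩
    · intro hg
      obtain ⟨t, ht⟩ := h2 g (congrArg Subtype.val hg)
      exact ⟨t, ht⟩
    · rintro ⟨t, rfl⟩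
      refine Subtype.ext ?_
      change ((show Y ⟶ E₀ from t) ≫ k) ≫ p = 0
      rw [Category.assoc, hk, comp_zero]
    · intro f
      obtain ⟨g, hg⟩ := h1 (show I.mor Y X from f).1 (show I.mor Y X from f).2
      exact ⟨g, Subtype.ext hg⟩

end Modules

end QHCat

end

noncomputable section

namespace QHCat

open Opposite

/-! ### Ideals of quotient categories -/

namespace CatIdeal

variable {C : Type u} [Category.{v} C] [Preadditive C]

lemma proj_map_eq_iff (I : CatIdeal C) {X Y : C} (f g : X ⟶ Y) :
    I.proj.map f = I.proj.map g ↔ f - g ∈ I.mor X Y :=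
  CategoryTheory.Quotient.functor_map_eq_iff I.rel f g

lemma proj_map_eq_zero_iff (I : CatIdeal C) {X Y : C} (f : X ⟶ Y) :
    I.proj.map f = 0 ↔ f ∈ I.mor X Y := by
  rw [← I.proj.map_zero X Y, proj_map_eq_iff, sub_zero]

lemma proj_map_mem_modulo {I J : CatIdeal C} {X Y : C} {f : X ⟶ Y} (hf : f ∈ J.mor X Y) :
    I.proj.map f ∈ (J.modulo I).mor (I.proj.obj X) (I.proj.obj Y) :=
  ⟨f, hf, rfl⟩

lemma exists_of_mem_modulo {I J : CatIdeal C} {X Y : I.QuotCat} {f : X ⟶ Y}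
    (hf : f ∈ (J.modulo I).mor X Y) :
    ∃ f' : X.as ⟶ Y.as, f' ∈ J.mor X.as Y.as ∧ I.proj.map f' = f :=
  hf

lemma comp_mem_mul {I J : CatIdeal C} {X Y Z : C} {f : X ⟶ Y} {g : Y ⟶ Z} (hf : f ∈ I.mor X Y)
    (hg : g ∈ J.mor Y Z) : f ≫ g ∈ (I.mul J).mor X Z :=
  AddSubgroup.subset_closure ⟨Y, f, g, hf, hg, rfl⟩

lemma mul_mor_le {I J : CatIdeal C} {X Z : C} {S : AddSubgroup (X ⟶ Z)}
    (h : ∀ (Y : C) (f : X ⟶ Y) (g : Y ⟶ Z), f ∈ I.mor X Y → g ∈ J.mor Y Z → f ≫ g ∈ S) :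
    (I.mul J).mor X Z ≤ S := by
  refine (AddSubgroup.closure_le _).2 ?_
  rintro _ ⟨Y, f, g, hf, hg, rfl⟩
  exact h Y f g hf hg

lemma proj_map_mem_rad (I : CatIdeal C) {X Y : C} {f : X ⟶ Y} (hf : f ∈ (rad C).mor X Y) :
    I.proj.map f ∈ (rad I.QuotCat).mor (I.proj.obj X) (I.proj.obj Y) := by
  intro g
  obtain ⟨g, rfl⟩ := I.proj.map_surjective (X := Y) (Y := X) g
  have : IsIso (𝟙 X - f ≫ g) := hf g
  have h : 𝟙 (I.proj.obj X) - I.proj.map f ≫ I.proj.map g = I.proj.map (𝟙 X - f ≫ g) := by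
    rw [Functor.map_sub, Functor.map_comp, CategoryTheory.Functor.map_id]
  rw [h]
  infer_instance

/-- The ring homomorphism `End(X) ⟶ End(X)/I(X, X)`. -/
def projEnd (I : CatIdeal C) (X : C) : End X →+* End (I.proj.obj X) where
  toFun f := I.proj.map f
  map_one' := I.proj.map_id X
  map_mul' f g := I.proj.map_comp g f
  map_zero' := I.proj.map_zero X X
  map_add' _ _ := I.proj.map_add

end CatIdeal

/-! ### Filtrations -/

section Filtration

variable {C : Type u} [Category.{v} C] [Preadditive C] [HasZeroObject C]
  [HasBinaryBiproducts C]

namespace ExhaustiveFiltration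

variable (B : ExhaustiveFiltration C)

lemma mem_ideal_of_source {j : ℕ} {X Y : C} (hX : B.sub j X) (f : X ⟶ Y) :
    f ∈ (B.ideal j).mor X Y :=
  ⟨X, 𝟙 X, f, hX, Category.id_comp f⟩

lemma mem_ideal_of_target {j : ℕ} {X Y : C} (hY : B.sub j Y) (f : X ⟶ Y) :
    f ∈ (B.ideal j).mor X Y :=
  ⟨Y, f, 𝟙 Y, hY, Category.comp_id f⟩

/-- Lets finitely many generators with sources in `B.sub j` be replaced by one. -/
lemma exists_sum (j : ℕ) {X : C} (n : ℕ) (F : Fin n → C) (q : ∀ i, F i ⟶ X)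
    (hF : ∀ i, B.sub j (F i)) :
    ∃ (E : C) (s : E ⟶ X), B.sub j E ∧ ∀ i, ∃ c : F i ⟶ E, c ≫ s = q i := by
  induction n with
  | zero =>
    obtain ⟨Z, hZ⟩ := HasZeroObject.zero (C := C)
    exact ⟨Z, 0, (B.additive j).of_isZero Z hZ, fun i => i.elim0⟩
  | succ n ih =>
    obtain ⟨E, s, hE, h⟩ := ih (fun i => F i.castSucc) (fun i => q i.castSucc)
      (fun i => hF i.castSucc)
    refine ⟨E ⊞ F (Fin.last n), biprod.desc s (q (Fin.last n)),
      (B.additive j).biprod _ _ hE (hF _), fun i => ?_⟩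
    induction i using Fin.lastCases with
    | last => exact ⟨biprod.inr, biprod.inr_desc _ _⟩
    | cast i =>
      obtain ⟨c, hc⟩ := h i
      exact ⟨c ≫ biprod.inl, by rw [Category.assoc, biprod.inl_desc, hc]⟩

/-- There is a presentation `C(-, E₀) ⟶ C(-, E₁) ⟶ I_{B_j}(-, X) ⟶ 0`, with
`E₁` in `B_j` and `E₀` in `B_{j-1}`. -/
def HasPresentation (j : ℕ) (X : C) : Prop :=
  ∃ E₀ E₁ : C, B.sub (j - 1) E₀ ∧ B.sub j E₁ ∧
    ∃ (k : E₀ ⟶ E₁) (p : E₁ ⟶ X), p ∈ (B.ideal j).mor E₁ X ∧ k ≫ p = 0 ∧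
      (∀ {Y : C} (f : Y ⟶ X), f ∈ (B.ideal j).mor Y X → ∃ g : Y ⟶ E₁, g ≫ p = f) ∧
      (∀ {Y : C} (g : Y ⟶ E₁), g ≫ p = 0 → ∃ t : Y ⟶ E₀, t ≫ k = g)

/-- Base case of the induction: $I_0=0$. Since `0 - 1 = 0` in `ℕ`, both terms are taken to be zero
objects. -/
lemma hasPresentation_zero (X : C) : B.HasPresentation 0 X := by
  obtain ⟨Z, hZ⟩ := HasZeroObject.zero (C := C)
  have hZ' := (B.additive 0).of_isZero Z hZ
  refine ⟨Z, Z, hZ', hZ', 0, 0, zero_mem _, zero_comp, ?_, fun g _ => ⟨g, hZ.eq_of_tgt _ _⟩⟩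
  rintro Y _ ⟨E, a, b, hE, rfl⟩
  refine ⟨0, ?_⟩
  rw [((B.zero E).1 hE).eq_of_src b 0, comp_zero, comp_zero]

/-! ### Presentations give heredity -/

lemma idem_modulo (i j : ℕ) :
    ((B.ideal j).modulo (B.ideal i)).mul ((B.ideal j).modulo (B.ideal i)) =
      (B.ideal j).modulo (B.ideal i) := by
  ext X Z f
  refine ⟨fun hf => ?_, fun hf => ?_⟩
  · exact CatIdeal.mul_mor_le (fun Y f g _ hg => CatIdeal.comp_left _ f hg) hf
  · obtain ⟨_, ⟨E, a, b, hE, rfl⟩, rfl⟩ := CatIdeal.exists_of_mem_modulo hf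
    rw [Functor.map_comp]
    exact CatIdeal.comp_mem_mul
      (CatIdeal.proj_map_mem_modulo (B.mem_ideal_of_target hE a))
      (CatIdeal.proj_map_mem_modulo (B.mem_ideal_of_source hE b))

lemma finGen_projective_of_hasPresentation {i j : ℕ} (hj : j - 1 ≤ i) (hij : i ≤ j) {X : C}
    (h : B.HasPresentation j X) :
    IsFinGen (((B.ideal j).modulo (B.ideal i)).submodule ((B.ideal i).proj.obj X)) ∧
      Projective (((B.ideal j).modulo (B.ideal i)).submodule ((B.ideal i).proj.obj X)) := by
  obtain ⟨E₀, E₁, hE₀, hE₁, k, p, hp, hk, h1, h2⟩ := h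
  have hp' := CatIdeal.proj_map_mem_modulo (I := B.ideal i) hp
  have surj : ∀ {Y : (B.ideal i).QuotCat} (f : Y ⟶ (B.ideal i).proj.obj X),
      f ∈ ((B.ideal j).modulo (B.ideal i)).mor Y ((B.ideal i).proj.obj X) →
      ∃ g : Y ⟶ (B.ideal i).proj.obj E₁, g ≫ (B.ideal i).proj.map p = f := by
    intro Y f hf
    obtain ⟨f', hf', rfl⟩ := CatIdeal.exists_of_mem_modulo hf
    obtain ⟨g, rfl⟩ := h1 f' hf'
    exact ⟨(B.ideal i).proj.map g, ((B.ideal i).proj.map_comp g p).symm⟩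
  refine ⟨CatIdeal.isFinGen_of_lift _ _ hp' surj,
    CatIdeal.projective_of_unique_lift _ _ hp' surj ?_⟩
  intro Y g hg
  obtain ⟨g, rfl⟩ := (B.ideal i).proj.map_surjective (X := Y.as) (Y := E₁) g
  have hg' : (B.ideal i).proj.map (g ≫ p) = 0 := ((B.ideal i).proj.map_comp g p).trans hg
  refine ((B.ideal i).proj_map_eq_zero_iff g).2 ?_
  -- Here `g ≫ p` is only known to factor through some `F` in `B.sub i`. As `F` also lies in `B.sub
  -- j`, its map to `X` lifts along `p`, and subtracting the lift corrects `g` to a morphism killed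
  -- by `p` itself.
  obtain ⟨F, c, b, hF, hcb⟩ := ((B.ideal i).proj_map_eq_zero_iff _).1 hg'
  obtain ⟨l, rfl⟩ := h1 b (B.mem_ideal_of_source (B.mono hij F hF) b)
  obtain ⟨t, ht⟩ := h2 (g - c ≫ l) (by
    rw [Preadditive.sub_comp, Category.assoc, hcb, sub_self])
  have h3 : g - c ≫ l ∈ (B.ideal i).mor Y.as E₁ :=
    ⟨E₀, t, k, B.mono hj E₀ hE₀, ht⟩
  have h4 : c ≫ l ∈ (B.ideal i).mor Y.as E₁ := ⟨F, c, l, hF, rfl⟩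
  simpa using add_mem h3 h4

end ExhaustiveFiltration

/-! ### The radical modulo $I_{\mathcal B_i}$ -/

variable (K : Type w) [Field K] [Linear K C] (homFinite : ∀ X Y : C, FiniteDimensional K (X ⟶ Y))
  [IsIdempotentComplete C] (B : ExhaustiveFiltration C)

namespace ExhaustiveFiltration

-- If `𝟙 E - a ≫ b ≫ g` were not invertible, locality of $\mathrm{End}(E)$ would make `a ≫ b ≫ g`
-- invertible, and `E` would be a retract of `F`.
include homFinite in
lemma ideal_le_rad (i : ℕ) {E E' : C} (hE : Indecomposable E)
    (hEF : ∀ F, B.sub i F → ¬ IsSummand E F) :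
    (B.ideal i).mor E E' ≤ (CatIdeal.rad C).mor E E' := by
  rintro _ ⟨F, a, b, hF, rfl⟩ g
  by_contra hcon
  have := isIso_of_not_isIso_one_sub K homFinite hE _ hcon
  refine hEF F hF (isSummand_of_retract (inv ((a ≫ b) ≫ g) ≫ a) (b ≫ g) ?_)
  have h := IsIso.inv_hom_id ((a ≫ b) ≫ g)
  simpa only [Category.assoc] using h

-- Identities of objects of $\mathcal B_j$ lie in $I_j$, so $f=1\cdot f\cdot 1$ has its class in
-- $I\cdot\mathrm{rad}\cdot I=0$.
omit [IsIdempotentComplete C] in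
lemma rad_le_ideal_of_isHeredity {i j : ℕ}
    (h : ((B.ideal j).modulo (B.ideal i)).IsHeredity) {E E' : C} (hE : B.sub j E)
    (hE' : B.sub j E') :
    (CatIdeal.rad C).mor E E' ≤ (B.ideal i).mor E E' := by
  intro f hf
  have h1 := CatIdeal.comp_mem_mul (CatIdeal.comp_mem_mul
    (CatIdeal.proj_map_mem_modulo (I := B.ideal i) (B.mem_ideal_of_source hE (𝟙 E)))
    ((B.ideal i).proj_map_mem_rad hf))
    (CatIdeal.proj_map_mem_modulo (I := B.ideal i) (B.mem_ideal_of_source hE' (𝟙 E')))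
  rw [h.mul_rad_mul] at h1
  rw [← (B.ideal i).proj_map_eq_zero_iff]
  have h2 : ((B.ideal i).proj.map (𝟙 E) ≫ (B.ideal i).proj.map f) ≫
      (B.ideal i).proj.map (𝟙 E') = 0 := h1
  simpa only [CategoryTheory.Functor.map_id, Category.id_comp, Category.comp_id] using h2

include homFinite in
/-- If the radical agrees with `I_{B_i}` between the indecomposables of `B_j` outside of `B_i`,
then the radical of `C / I_{B_i}` vanishes on the objects of `B_j`. -/
lemma mem_ideal_of_proj_mem_rad (hB : ∀ i, IsClosedUnderSummands (B.sub i)) {i j : ℕ}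
    (hrad : ∀ E E' : C, Indecomposable E → Indecomposable E' → B.sub j E → B.sub j E' →
        (∀ F, B.sub i F → ¬ IsSummand E F) → (∀ F, B.sub i F → ¬ IsSummand E' F) →
        (CatIdeal.rad C).mor E E' = (B.ideal i).mor E E')
    (E E' : C) (hE : B.sub j E) (hE' : B.sub j E') (f : E ⟶ E')
    (hf : (B.ideal i).proj.map f ∈ (CatIdeal.rad (B.ideal i).QuotCat).mor
      ((B.ideal i).proj.obj E) ((B.ideal i).proj.obj E')) :
    f ∈ (B.ideal i).mor E E' := by
  revert hE f
  refine induction_on_indecomposables K homFinite (fun E => B.sub j E → ∀ f : E ⟶ E',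
    (B.ideal i).proj.map f ∈ (CatIdeal.rad (B.ideal i).QuotCat).mor
      ((B.ideal i).proj.obj E) ((B.ideal i).proj.obj E') → f ∈ (B.ideal i).mor E E') ?_ ?_ ?_ E
  · intro X hX _ f _
    rw [hX.eq_of_src f 0]
    exact zero_mem _
  · intro E hEi hE
    revert hE'
    refine induction_on_indecomposables K homFinite (fun E' => B.sub j E' → ∀ f : E ⟶ E',
      (B.ideal i).proj.map f ∈ (CatIdeal.rad (B.ideal i).QuotCat).mor
        ((B.ideal i).proj.obj E) ((B.ideal i).proj.obj E') → f ∈ (B.ideal i).mor E E') ?_ ?_ ?_ E'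
    · intro X hX _ f _
      rw [hX.eq_of_tgt f 0]
      exact zero_mem _
    · intro E' hEi' hE' f hf
      by_cases h1 : ∃ F, B.sub i F ∧ IsSummand E F
      · obtain ⟨F, hF, hEF⟩ := h1
        exact B.mem_ideal_of_source (hB i E F hEF hF) f
      by_cases h2 : ∃ F, B.sub i F ∧ IsSummand E' F
      · obtain ⟨F, hF, hEF⟩ := h2
        exact B.mem_ideal_of_target (hB i E' F hEF hF) f
      have h1' : ∀ F, B.sub i F → ¬ IsSummand E F := fun F hF hEF => h1 ⟨F, hF, hEF⟩
      have h2' : ∀ F, B.sub i F → ¬ IsSummand E' F := fun F hF hEF => h2 ⟨F, hF, hEF⟩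
      rw [← hrad E E' hEi hEi' hE hE' h1' h2']
      -- If `f` were not radical in `C`, some `f ≫ g` would be invertible. Testing the class of `f`
      -- against `g ≫ inv (f ≫ g)` then makes $1-1=0$ invertible in the quotient, so `𝟙 E` factors
      -- through `B.sub i`, contrary to `h1'`.
      intro g
      by_contra hcon
      have hiso := isIso_of_not_isIso_one_sub K homFinite hEi _ hcon
      have h3 : IsIso (𝟙 ((B.ideal i).proj.obj E) - (B.ideal i).proj.map f ≫
          (B.ideal i).proj.map (g ≫ inv (f ≫ g))) := hf _
      rw [← Functor.map_comp, ← Category.assoc, IsIso.hom_inv_id, CategoryTheory.Functor.map_id, sub_self] at h3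
      have h4 : (B.ideal i).proj.map (𝟙 E) = 0 := by
        rw [CategoryTheory.Functor.map_id]
        have h5 := IsIso.hom_inv_id (0 : (B.ideal i).proj.obj E ⟶ (B.ideal i).proj.obj E)
        rw [zero_comp] at h5
        exact h5.symm
      obtain ⟨F, a, b, hF, hab⟩ := ((B.ideal i).proj_map_eq_zero_iff _).1 h4
      exact h1' F hF (isSummand_of_retract a b hab)
    · intro X Y Z φ hY hZ hX f hf
      have hY' : B.sub j Y := hB j Y X ⟨Z, ⟨φ⟩⟩ hX
      have hZ' : B.sub j Z := hB j Z X ⟨Y, ⟨φ ≪≫ biprod.braiding Y Z⟩⟩ hX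
      have h1 := hY hY' (f ≫ φ.hom ≫ biprod.fst) (by
        rw [Functor.map_comp]; exact CatIdeal.comp_right _ _ hf)
      have h2 := hZ hZ' (f ≫ φ.hom ≫ biprod.snd) (by
        rw [Functor.map_comp]; exact CatIdeal.comp_right _ _ hf)
      have h3 := add_mem (CatIdeal.comp_right _ (biprod.inl ≫ φ.inv) h1)
        (CatIdeal.comp_right _ (biprod.inr ≫ φ.inv) h2)
      have h4 : (f ≫ φ.hom ≫ biprod.fst) ≫ biprod.inl ≫ φ.inv +
          (f ≫ φ.hom ≫ biprod.snd) ≫ biprod.inr ≫ φ.inv = f := by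
        calc _ = f ≫ φ.hom ≫ (biprod.fst ≫ biprod.inl + biprod.snd ≫ biprod.inr) ≫ φ.inv := by
              simp only [Category.assoc, Preadditive.comp_add, Preadditive.add_comp]
          _ = f := by simp
      rwa [h4] at h3
  · intro X Y Z φ hY hZ hX f hf
    have hY' : B.sub j Y := hB j Y X ⟨Z, ⟨φ⟩⟩ hX
    have hZ' : B.sub j Z := hB j Z X ⟨Y, ⟨φ ≪≫ biprod.braiding Y Z⟩⟩ hX
    have h1 := hY hY' ((biprod.inl ≫ φ.inv) ≫ f) (by
      rw [Functor.map_comp]; exact CatIdeal.comp_left _ _ hf)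
    have h2 := hZ hZ' ((biprod.inr ≫ φ.inv) ≫ f) (by
      rw [Functor.map_comp]; exact CatIdeal.comp_left _ _ hf)
    have h3 := add_mem (CatIdeal.comp_left _ (φ.hom ≫ biprod.fst) h1)
      (CatIdeal.comp_left _ (φ.hom ≫ biprod.snd) h2)
    have h4 : (φ.hom ≫ biprod.fst) ≫ (biprod.inl ≫ φ.inv) ≫ f +
        (φ.hom ≫ biprod.snd) ≫ (biprod.inr ≫ φ.inv) ≫ f = f := by
      calc _ = φ.hom ≫ (biprod.fst ≫ biprod.inl + biprod.snd ≫ biprod.inr) ≫ φ.inv ≫ f := by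
            simp only [Category.assoc, Preadditive.comp_add, Preadditive.add_comp]
        _ = f := by simp
    rwa [h4] at h3

include homFinite in
lemma mul_rad_mul_eq_zero (hB : ∀ i, IsClosedUnderSummands (B.sub i)) {i j : ℕ}
    (hrad : ∀ E E' : C, Indecomposable E → Indecomposable E' → B.sub j E → B.sub j E' →
        (∀ F, B.sub i F → ¬ IsSummand E F) → (∀ F, B.sub i F → ¬ IsSummand E' F) →
        (CatIdeal.rad C).mor E E' = (B.ideal i).mor E E') :
    (((B.ideal j).modulo (B.ideal i)).mul (CatIdeal.rad _)).mul
      ((B.ideal j).modulo (B.ideal i)) = CatIdeal.zero _ := by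
  ext X Z f
  refine ⟨fun hf => ?_, fun hf => ?_⟩
  swap
  · have : f = 0 := hf
    rw [this]
    exact zero_mem _
  refine CatIdeal.mul_mor_le (fun Y f g hf hg => ?_) hf
  obtain ⟨_, ⟨E', c, d, hE', rfl⟩, rfl⟩ := CatIdeal.exists_of_mem_modulo hg
  -- Pulling the zero subgroup back along composition with `c ≫ d` reduces the claim to the inner
  -- product.
  refine CatIdeal.mul_mor_le (S := AddSubgroup.comap
    (Preadditive.rightComp X ((B.ideal i).proj.map (c ≫ d))) ((CatIdeal.zero _).mor X Z))
    (fun W h r hh hr => ?_) hf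
  obtain ⟨_, ⟨E, a, b, hE, rfl⟩, rfl⟩ := CatIdeal.exists_of_mem_modulo hh
  change ((B.ideal i).proj.map (a ≫ b) ≫ r) ≫ (B.ideal i).proj.map (c ≫ d) = 0
  -- This is a radical morphism of the quotient between objects of `B.sub j`.
  have h0 : (B.ideal i).proj.map b ≫ r ≫ (B.ideal i).proj.map c = 0 := by
    have hmem := CatIdeal.comp_left _ ((B.ideal i).proj.map b)
      (CatIdeal.comp_right _ ((B.ideal i).proj.map c) hr)
    obtain ⟨s, hs⟩ := (B.ideal i).proj.map_surjective (X := E) (Y := E')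
      ((B.ideal i).proj.map b ≫ r ≫ (B.ideal i).proj.map c)
    rw [← hs] at hmem ⊢
    exact ((B.ideal i).proj_map_eq_zero_iff s).2
      (B.mem_ideal_of_proj_mem_rad K homFinite hB hrad E E' hE hE' s hmem)
  calc _ = (B.ideal i).proj.map a ≫ ((B.ideal i).proj.map b ≫ r ≫ (B.ideal i).proj.map c) ≫
        (B.ideal i).proj.map d := by simp only [Functor.map_comp, Category.assoc]
    _ = 0 := by rw [h0, zero_comp, comp_zero]

/-! ### Heredity gives presentations -/

include homFinite in
/-- If `I_{B_j}/I_{B_i}(-, X)` is finitely generated projective, then it is representable, by an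
object of `B_j`. -/
lemma exists_representing (hB : ∀ i, IsClosedUnderSummands (B.sub i)) {i j : ℕ}
    (X : C)
    (hfg : IsFinGen (((B.ideal j).modulo (B.ideal i)).submodule ((B.ideal i).proj.obj X)))
    (hpr : Projective (((B.ideal j).modulo (B.ideal i)).submodule ((B.ideal i).proj.obj X))) :
    ∃ (E : C) (p : E ⟶ X), B.sub j E ∧
      (∀ {Y : C} (f : Y ⟶ X), f ∈ (B.ideal j).mor Y X →
        ∃ g : Y ⟶ E, f - g ≫ p ∈ (B.ideal i).mor Y X) ∧
      (∀ {Y : C} (g : Y ⟶ E), g ≫ p ∈ (B.ideal i).mor Y X → g ∈ (B.ideal i).mor Y E) := by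
  obtain ⟨n, G, p, hp, hgen⟩ := CatIdeal.exists_generators _ hfg
  have hfac : ∀ l, ∃ (F : C) (a : (G l).as ⟶ F) (b : F ⟶ X), B.sub j F ∧
      (B.ideal i).proj.map (a ≫ b) = p l := by
    intro l
    obtain ⟨_, ⟨F, a, b, hF, rfl⟩, e⟩ := CatIdeal.exists_of_mem_modulo (hp l)
    exact ⟨F, a, b, hF, e⟩
  choose F a b hF hab using hfac
  obtain ⟨E, s, hE, hs⟩ := B.exists_sum j n F b hF
  choose c hc using hs
  have surj : ∀ {Y : (B.ideal i).QuotCat} (f : Y ⟶ (B.ideal i).proj.obj X),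
      f ∈ ((B.ideal j).modulo (B.ideal i)).mor Y ((B.ideal i).proj.obj X) →
      ∃ g : Y ⟶ (B.ideal i).proj.obj E, g ≫ (B.ideal i).proj.map s = f := by
    intro Y f hf
    obtain ⟨g, rfl⟩ := hgen f hf
    refine ⟨∑ l, g l ≫ (B.ideal i).proj.map (a l ≫ c l), ?_⟩
    rw [Preadditive.sum_comp]
    refine Finset.sum_congr rfl fun l _ => ?_
    rw [← hab l, Category.assoc, ← hc l, ← Category.assoc (a l), Functor.map_comp _ (a l ≫ c l)]
  obtain ⟨e, he, hep, hek⟩ := CatIdeal.exists_idempotent_of_projective _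
    ((B.ideal i).proj.map s)
    (CatIdeal.proj_map_mem_modulo (B.mem_ideal_of_source hE s)) surj
  -- The idempotent `e` lives in the quotient category. It is lifted to `End E` and split in `C`;
  -- its image `E'` is the representing object.
  have : FiniteDimensional K (End E) := homFinite E E
  obtain ⟨e₀, rfl⟩ := (B.ideal i).proj.map_surjective (X := E) (Y := E) e
  obtain ⟨e₁, he₁, he₁'⟩ := exists_idempotent_lift K ((B.ideal i).projEnd E) e₀ he
  have hee : (B.ideal i).proj.map e₁ = (B.ideal i).proj.map e₀ := he₁'
  rw [← hee] at he hep hek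
  obtain ⟨E', ι, π, h1, h2⟩ := IsIdempotentComplete.idempotents_split E e₁ he₁
  refine ⟨E', ι ≫ s, hB j E' E (isSummand_of_retract ι π h1) hE, ?_, ?_⟩
  · intro Y f hf
    obtain ⟨g, hg⟩ := surj _ (CatIdeal.proj_map_mem_modulo (I := B.ideal i) hf)
    obtain ⟨g, rfl⟩ := (B.ideal i).proj.map_surjective (X := Y) (Y := E) g
    refine ⟨g ≫ π, ?_⟩
    rw [← CatIdeal.proj_map_eq_iff]
    calc (B.ideal i).proj.map f
        = (B.ideal i).proj.map g ≫ (B.ideal i).proj.map e₁ ≫ (B.ideal i).proj.map s := by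
          rw [hep, hg]
      _ = _ := by rw [← h2]; simp only [Functor.map_comp, Category.assoc]
  · intro Y g hg
    have h3 := hek ((B.ideal i).proj.map (g ≫ ι)) (by
      rw [← Functor.map_comp, Category.assoc]
      exact ((B.ideal i).proj_map_eq_zero_iff _).2 hg)
    rw [← Functor.map_comp, CatIdeal.proj_map_eq_zero_iff, ← h2] at h3
    have h4 := CatIdeal.comp_right _ π h3
    simpa only [Category.assoc, h1, reassoc_of% h1, Category.comp_id] using h4

-- Together `p` and a cover `q` of $I_j(-,X)$ cover $I_{j+1}(-,X)$. In a relation $g_1p+g_2q=0$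
-- (diagrammatic order), $g_1p\in I_j$, so $g_1=sr$ for a cover `r` of $I_j(-,E)$. With $rp=lq$, the
-- remainder $sl+g_2$ is killed by `q`, hence factors through `k`. This dictates the matrix with
-- rows $(r,-l)$ and $(0,k)$.
omit [IsIdempotentComplete C] in
lemma hasPresentation_succ {j : ℕ} (ih : ∀ X, B.HasPresentation j X) {X E : C} (p : E ⟶ X)
    (hE : B.sub (j + 1) E)
    (h1 : ∀ {Y : C} (f : Y ⟶ X), f ∈ (B.ideal (j + 1)).mor Y X →
        ∃ g : Y ⟶ E, f - g ≫ p ∈ (B.ideal j).mor Y X)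
    (h2 : ∀ {Y : C} (g : Y ⟶ E), g ≫ p ∈ (B.ideal j).mor Y X → g ∈ (B.ideal j).mor Y E) :
    B.HasPresentation (j + 1) X := by
  obtain ⟨G₀, G₁, hG₀, hG₁, k, q, hq, hk, hq1, hq2⟩ := ih X
  obtain ⟨-, F, -, hF, -, r, hr, -, hr1, -⟩ := ih E
  obtain ⟨l, hl⟩ := hq1 (r ≫ p) (CatIdeal.comp_right _ p hr)
  have hsub := (B.additive (j + 1)).biprod E G₁ hE (B.mono (Nat.le_succ j) _ hG₁)
  refine ⟨F ⊞ G₀, E ⊞ G₁,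
    (B.additive j).biprod _ _ hF (B.mono (Nat.sub_le j 1) _ hG₀), hsub,
    biprod.desc (biprod.lift r (-l)) (biprod.lift 0 k), biprod.desc p q,
    B.mem_ideal_of_source hsub _, ?_, ?_, ?_⟩
  · ext
    · simp [biprod.lift_desc, hl]
    · simp [biprod.lift_desc, hk]
  · intro Y f hf
    obtain ⟨g, hg⟩ := h1 f hf
    obtain ⟨g', hg'⟩ := hq1 _ hg
    exact ⟨biprod.lift g g', by rw [biprod.lift_desc, hg']; abel⟩
  · intro Y g hg
    have hg0 : (g ≫ biprod.fst) ≫ p + (g ≫ biprod.snd) ≫ q = 0 := by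
      rw [← hg, biprod.desc_eq, Preadditive.comp_add, Category.assoc, Category.assoc]
    have hg1 : (g ≫ biprod.fst) ≫ p ∈ (B.ideal j).mor Y X := by
      rw [eq_neg_of_add_eq_zero_left hg0]
      exact neg_mem (CatIdeal.comp_left _ _ hq)
    obtain ⟨s, hs⟩ := hr1 _ (h2 _ hg1)
    obtain ⟨t, ht⟩ := hq2 (s ≫ l + g ≫ biprod.snd) (by
      rw [Preadditive.add_comp, Category.assoc, hl, ← Category.assoc, hs, hg0])
    refine ⟨biprod.lift s t, ?_⟩
    rw [biprod.lift_desc]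
    ext
    · simpa using hs
    · simp [ht]

include homFinite in
lemma hasPresentation_of_isQuasiHereditary (hB : ∀ i, IsClosedUnderSummands (B.sub i))
    (h : IsQuasiHereditary B) (j : ℕ) (X : C) : B.HasPresentation j X := by
  -- The step uses the presentations at level `j` of both `X` and the representing object `E`.
  induction j generalizing X with
  | zero => exact B.hasPresentation_zero X
  | succ j ih =>
    have hj := h (j + 1) (Nat.succ_pos j)
    obtain ⟨E, p, hE, h1, h2⟩ := B.exists_representing K homFinite hB X
      (hj.finGen _) (hj.projective _)
    exact B.hasPresentation_succ ih p hE h1 h2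

end ExhaustiveFiltration

end Filtration

end QHCat

end

/-! ### Equivalence of quasi-heredity with (i) and (ii) -/

theorem theorem2p4 {K : Type w} [Field K] [IsAlgClosed K]
    {C : Type u} [CategoryTheory.Category.{v} C] [CategoryTheory.Preadditive C]
    [CategoryTheory.Linear K C] [CategoryTheory.Limits.HasZeroObject C]
    [CategoryTheory.Limits.HasBinaryBiproducts C]
    [CategoryTheory.IsIdempotentComplete C]
    (homFinite : ∀ X Y : C, FiniteDimensional K (X ⟶ Y))
    (B : QHCat.ExhaustiveFiltration C)
    (hB : ∀ i, QHCat.IsClosedUnderSummands (B.sub i)) :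
    QHCat.IsQuasiHereditary B ↔
      (∀ j : ℕ, 1 ≤ j → ∀ E E' : C,
        CategoryTheory.Indecomposable E → CategoryTheory.Indecomposable E' →
        B.sub j E → B.sub j E' →
        (∀ F, B.sub (j - 1) F → ¬ QHCat.IsSummand E F) →
        (∀ F, B.sub (j - 1) F → ¬ QHCat.IsSummand E' F) →
        (QHCat.CatIdeal.rad C).mor E E' = (B.ideal (j - 1)).mor E E') ∧
      (∀ (X : C) (j : ℕ), 1 ≤ j → ∃ E₀ E₁ : C, B.sub (j - 1) E₀ ∧ B.sub j E₁ ∧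
        ∃ (a : QHCat.representable E₀ ⟶ QHCat.representable E₁)
          (p : QHCat.representable E₁ ⟶ (B.ideal j).submodule X), QHCat.IsRightExact a p) := by
  have key : ∀ (X : C) (j : ℕ), (∃ E₀ E₁ : C, B.sub (j - 1) E₀ ∧ B.sub j E₁ ∧
        ∃ (a : QHCat.representable E₀ ⟶ QHCat.representable E₁)
          (p : QHCat.representable E₁ ⟶ (B.ideal j).submodule X), QHCat.IsRightExact a p) ↔
      B.HasPresentation j X := by
    intro X j
    simp only [QHCat.CatIdeal.exists_isRightExact_iff]
    rfl
  simp only [key]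
  constructor
  · intro h
    refine ⟨fun j hj E E' hEi _ hE hE' hEs _ => ?_, fun X j _ =>
      B.hasPresentation_of_isQuasiHereditary K homFinite hB h j X⟩
    exact le_antisymm (B.rad_le_ideal_of_isHeredity (h j hj) hE hE')
      (B.ideal_le_rad K homFinite _ hEi hEs)
  · rintro ⟨hrad, hpres⟩ j hj
    have hfp := fun X : C =>
      B.finGen_projective_of_hasPresentation le_rfl (Nat.sub_le j 1) (hpres X j hj)
    exact
      { idem := B.idem_modulo _ _
        mul_rad_mul := B.mul_rad_mul_eq_zero K homFinite hB (hrad j hj)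
        finGen := fun X => (hfp X.as).1
        projective := fun X => (hfp X.as).2 }
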